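/- Let $\mathcal C$ be a triangulated category with suspension $\Sigma$, and let $\mathcal E$ be a proper class of triangles in $\mathcal C$ in the sense of Beligiannis: a class of distinguished triangles that contains all splitting triangles (those with zero third morphism), is closed under isomorphisms, finite coproducts, suspensions, base change and cobase change, and is saturated (if a base change of a distinguished triangle along a morphism $\varepsilon$ lies in $\mathcal E$, where $\varepsilon$ is the second morphism of some triangle in $\mathcal E$, then the given triangle lies in $\mathcal E$). Let $\mathbb E(Z,X)=\mathrm{Ph}_{\mathcal E}(Z,\Sigma X)$ be the group of all morphisms $Z\to\Sigma X$ that are third morphisms of triangles in $\mathcal E$. An object $P$ is $\mathcal E$-projective if for every triangle $A\to B\to C\to\Sigma A$ in $\mathcal E$ every morphism $P\to C$ factors through $B\to C$; $\mathcal E$-injectives are defined dually. Suppose that there are enough $\mathcal E$-projectives and enough $\mathcal E$-injectives: every object $A$ occurs in triangles $\Omega A\to P\to A\to\Sigma\Omega A$ and $A\to I\to L\to\Sigma A$ of $\mathcal E$ with $P$ $\mathcal E$-projective and $I$ $\mathcal E$-injective. Fix a choice of such syzygies $\Omega A$ and put $\mathbb E^{i+1}(X,Y)=\mathbb E(\Omega^iX,Y)$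 for $i\ge 0$. An $\mathcal E$-triangle sequence $K\to X_n\to\cdots\to X_1\to A$ is given by triangles $K_i\to X_i\to K_{i-1}\to\Sigma K_i$ in $\mathcal E$ for $1\le i\le n$, with $K_0=A$ and $K_n=K$. The $\mathcal E$-projective dimension $\mathrm{pd}_{\mathcal E}(A)$ is the least $n\ge 0$ for which there is an $\mathcal E$-triangle sequence $P_n\to P_{n-1}\to\cdots\to P_0\to A$ with all $P_i$ $\mathcal E$-projective (for $n=0$: $A$ itself is $\mathcal E$-projective), and $\infty$ if there is none. All subcategories are full, additive and closed under isomorphisms. Let $n\ge 1$ and let $\mathcal T$ be a subcategory of $\mathcal C$. Put $\mathcal T_{\mathcal E}^{\perp}=\{Y : \mathbb E^i(T,Y)=0 \text{ for all } i\ge 1,\ T\in\mathcal T\}$, and let $\mathrm{Pres}^n(\mathcal T)$ consist of the objects $A$ admitting an $\mathcal E$-triangle sequence $A'\to T_n\to\cdots\to T_1\to A$ with all $T_i\in\mathcal T$. A subcategory $\mathcal T$ closed under direct summands is called tilting (of projective dimension $n$) if (1) $\mathrm{pd}_{\mathcal E}(T)\le n$ for all $T\in\mathcal T$, and (2) $\mathcal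 T$ is a generator for $\mathcal T_{\mathcal E}^{\perp}$, i.e. $\mathcal T\subseteq\mathcal T_{\mathcal E}^{\perp}$ and every $Y\in\mathcal T_{\mathcal E}^{\perp}$ has a triangle $Y'\to T\to Y\to\Sigma Y'$ in $\mathcal E$ with $T\in\mathcal T$ and $Y'\in\mathcal T_{\mathcal E}^{\perp}$. Assume that $\mathcal T$ is closed under direct summands and that every object $A\in\mathcal T_{\mathcal E}^{\perp}$ has a right $\mathcal T$-approximation, i.e. a morphism $f:X\to A$ with $X\in\mathcal T$ through which every morphism $X'\to A$ with $X'\in\mathcal T$ factors. Then $\mathcal T$ is a tilting subcategory if and only if $\mathrm{Pres}^n(\mathcal T)=\mathcal T_{\mathcal E}^{\perp}$. -/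

import Mathlib

open CategoryTheory CategoryTheory.Limits CategoryTheory.Pretriangulated

universe v u

/-- A proper class of triangles in a triangulated category `C`: a class of distinguished
triangles which contains all splitting triangles (those with zero third morphism), is closed
under isomorphisms, finite coproducts, suspensions, base change and cobase change, and is
saturated. The zero triangle being splitting, binary coproducts suffice for finite ones. -/
structure ProperClass (C : Type u) [Category.{v} C] [Preadditive C] [HasZeroObject C]
    [HasShift C ℤ] [∀ n : ℤ, (shiftFunctor C n).Additive] [Pretriangulated C] where
  /-- the class of triangles -/
  triangles : ObjectProperty (Triangle C)
  distinguished : ∀ D : Triangle C, triangles D → D ∈ distTriang C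
  splitting : ∀ D : Triangle C, D ∈ distTriang C → D.mor₃ = 0 → triangles D
  closedUnderIso : triangles.IsClosedUnderIsomorphisms
  coproduct : ∀ {X₁ X₂ X₃ Y₁ Y₂ Y₃ : C}
    (f : X₁ ⟶ X₂) (g : X₂ ⟶ X₃) (h : X₃ ⟶ X₁⟦(1 : ℤ)⟧)
    (f' : Y₁ ⟶ Y₂) (g' : Y₂ ⟶ Y₃) (h' : Y₃ ⟶ Y₁⟦(1 : ℤ)⟧),
    triangles (Triangle.mk f g h) → triangles (Triangle.mk f' g' h') →
    triangles (Triangle.mk (biprod.map f f') (biprod.map g g')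
      (biprod.desc (h ≫ (biprod.inl : X₁ ⟶ X₁ ⊞ Y₁)⟦(1 : ℤ)⟧')
        (h' ≫ (biprod.inr : Y₁ ⟶ X₁ ⊞ Y₁)⟦(1 : ℤ)⟧')))
  suspension : ∀ (D : Triangle C) (i : ℤ), triangles D →
    triangles ((Triangle.shiftFunctor C i).obj D)
  baseChange : ∀ {X₁ X₂ X₃ Y₂ Y₃ : C}
    (f : X₁ ⟶ X₂) (g : X₂ ⟶ X₃) (h : X₃ ⟶ X₁⟦(1 : ℤ)⟧) (ε : Y₃ ⟶ X₃)
    (f' : X₁ ⟶ Y₂) (g' : Y₂ ⟶ Y₃),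
    triangles (Triangle.mk f g h) → Triangle.mk f' g' (ε ≫ h) ∈ distTriang C →
    triangles (Triangle.mk f' g' (ε ≫ h))
  cobaseChange : ∀ {X₁ X₂ X₃ Y₁ Y₂ : C}
    (f : X₁ ⟶ X₂) (g : X₂ ⟶ X₃) (h : X₃ ⟶ X₁⟦(1 : ℤ)⟧) (α : X₁ ⟶ Y₁)
    (f' : Y₁ ⟶ Y₂) (g' : Y₂ ⟶ X₃),
    triangles (Triangle.mk f g h) → Triangle.mk f' g' (h ≫ α⟦(1 : ℤ)⟧') ∈ distTriang C →
    triangles (Triangle.mk f' g' (h ≫ α⟦(1 : ℤ)⟧'))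
  /-- If `M ⟶ Y₃ ⟶ X₃ ⟶ M⟦1⟧` (with second map `ε`) is in the class, and so is the base change
  along `ε` of a distinguished triangle, then that distinguished triangle is in the class. -/
  saturated : ∀ {X₁ X₂ X₃ Y₂ Y₃ M : C}
    (f : X₁ ⟶ X₂) (g : X₂ ⟶ X₃) (h : X₃ ⟶ X₁⟦(1 : ℤ)⟧) (m : M ⟶ Y₃) (ε : Y₃ ⟶ X₃)
    (k : X₃ ⟶ M⟦(1 : ℤ)⟧) (f' : X₁ ⟶ Y₂) (g' : Y₂ ⟶ Y₃),
    Triangle.mk f g h ∈ distTriang C → triangles (Triangle.mk m ε k) →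
    triangles (Triangle.mk f' g' (ε ≫ h)) → triangles (Triangle.mk f g h)

namespace ProperClass

variable {C : Type u} [Category.{v} C] [Preadditive C] [HasZeroObject C] [HasShift C ℤ]
  [∀ n : ℤ, (shiftFunctor C n).Additive] [Pretriangulated C] (E : ProperClass C)

/-- `h : Z ⟶ X⟦1⟧` is an `E`-phantom map if it is the third morphism of a triangle in `E`. -/
def IsPhantom {Z X : C} (h : Z ⟶ X⟦(1 : ℤ)⟧) : Prop :=
  ∃ (Y : C) (f : X ⟶ Y) (g : Y ⟶ Z), E.triangles (Triangle.mk f g h)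

lemma isPhantom_zero (Z X : C) : E.IsPhantom (0 : Z ⟶ X⟦(1 : ℤ)⟧) :=
  ⟨X ⊞ Z, biprod.inl, biprod.snd,
    E.splitting _ (binaryBiproductTriangle_distinguished X Z) rfl⟩

variable {E} in
lemma IsPhantom.precomp {Z Z' X : C} {h : Z ⟶ X⟦(1 : ℤ)⟧} (hh : E.IsPhantom h) (c : Z' ⟶ Z) :
    E.IsPhantom (c ≫ h) := by
  obtain ⟨Y, f, g, hT⟩ := hh
  obtain ⟨Y', f', g', hT'⟩ := distinguished_cocone_triangle₂ (c ≫ h)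
  exact ⟨Y', f', g', E.baseChange f g h c f' g' hT hT'⟩

variable {E} in
lemma IsPhantom.postcomp {Z X X' : C} {h : Z ⟶ X⟦(1 : ℤ)⟧} (hh : E.IsPhantom h) (a : X ⟶ X') :
    E.IsPhantom (h ≫ a⟦(1 : ℤ)⟧') := by
  obtain ⟨Y, f, g, hT⟩ := hh
  obtain ⟨Y', f', g', hT'⟩ := distinguished_cocone_triangle₂ (h ≫ a⟦(1 : ℤ)⟧')
  exact ⟨Y', f', g', E.cobaseChange f g h a f' g' hT hT'⟩

variable {E} in
lemma IsPhantom.add {Z X : C} {h h' : Z ⟶ X⟦(1 : ℤ)⟧} (hh : E.IsPhantom h)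
    (hh' : E.IsPhantom h') : E.IsPhantom (h + h') := by
  obtain ⟨Y, f, g, hT⟩ := hh
  obtain ⟨Y', f', g', hT'⟩ := hh'
  have key : E.IsPhantom (biprod.desc (h ≫ (biprod.inl : X ⟶ X ⊞ X)⟦(1 : ℤ)⟧')
        (h' ≫ (biprod.inr : X ⟶ X ⊞ X)⟦(1 : ℤ)⟧')) :=
    ⟨_, _, _, E.coproduct f g h f' g' h' hT hT'⟩
  have := (key.precomp (biprod.lift (𝟙 Z) (𝟙 Z))).postcomp (biprod.desc (𝟙 X) (𝟙 X))
  have e : (biprod.lift (𝟙 Z) (𝟙 Z) ≫ biprod.desc (h ≫ (biprod.inl : X ⟶ X ⊞ X)⟦(1 : ℤ)⟧')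
        (h' ≫ (biprod.inr : X ⟶ X ⊞ X)⟦(1 : ℤ)⟧')) ≫
          (biprod.desc (𝟙 X) (𝟙 X))⟦(1 : ℤ)⟧' = h + h' := by
    simp [Preadditive.add_comp, ← Functor.map_comp]
  rwa [e] at this

variable {E} in
lemma IsPhantom.neg {Z X : C} {h : Z ⟶ X⟦(1 : ℤ)⟧} (hh : E.IsPhantom h) :
    E.IsPhantom (-h) := by
  simpa using hh.precomp (-𝟙 Z)

/-- The extension group `𝔼(Z, X) = Ph_E(Z, ΣX)` of all `E`-phantom maps `Z ⟶ ΣX`. -/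
def ext (Z X : C) : AddSubgroup (Z ⟶ X⟦(1 : ℤ)⟧) where
  carrier := {h | E.IsPhantom h}
  zero_mem' := E.isPhantom_zero Z X
  add_mem' := fun h h' => IsPhantom.add h h'
  neg_mem' := fun h => IsPhantom.neg h

/-- The `E`-projective objects. -/
def projectives : ObjectProperty C := fun P =>
  ∀ (D : Triangle C), E.triangles D → ∀ c : P ⟶ D.obj₃, ∃ b : P ⟶ D.obj₂, b ≫ D.mor₂ = c

/-- The `E`-injective objects. -/
def injectives : ObjectProperty C := fun I =>
  ∀ (D : Triangle C), E.triangles D → ∀ a : D.obj₁ ⟶ I, ∃ b : D.obj₂ ⟶ I, D.mor₁ ≫ b = a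

/-- Every object `A` is the end term of a triangle `K ⟶ P ⟶ A ⟶ ΣK` in `E` with `P`
`E`-projective. -/
def EnoughProjectives : Prop :=
  ∀ A : C, ∃ (K P : C) (f : K ⟶ P) (g : P ⟶ A) (h : A ⟶ K⟦(1 : ℤ)⟧),
    E.projectives P ∧ E.triangles (Triangle.mk f g h)

/-- Every object `A` is the first term of a triangle `A ⟶ I ⟶ L ⟶ ΣA` in `E` with `I`
`E`-injective. -/
def EnoughInjectives : Prop :=
  ∀ A : C, ∃ (I L : C) (f : A ⟶ I) (g : I ⟶ L) (h : L ⟶ A⟦(1 : ℤ)⟧),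
    E.injectives I ∧ E.triangles (Triangle.mk f g h)

/-- `E.TriangleSeq S n K A`: there is an `E`-triangle sequence
`K ⟶ Xₙ ⟶ ⋯ ⟶ X₁ ⟶ A` with all `Xᵢ` in `S`, i.e. there are triangles
`Kᵢ ⟶ Xᵢ ⟶ Kᵢ₋₁ ⟶ ΣKᵢ` in `E` for `1 ≤ i ≤ n`, with `K₀ = A` and `Kₙ = K`. -/
inductive TriangleSeq (S : ObjectProperty C) : ℕ → C → C → Prop
  | nil (A : C) : TriangleSeq S 0 A A
  | cons {n : ℕ} {K L X A : C} (f : L ⟶ X) (g : X ⟶ A) (h : A ⟶ L⟦(1 : ℤ)⟧)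
      (hD : E.triangles (Triangle.mk f g h)) (hX : S X) (hL : TriangleSeq S n K L) :
      TriangleSeq S (n + 1) K A

/-- The `E`-projective dimension of `A`: the least length `n` of an `E`-projective resolution
`Pₙ ⟶ Pₙ₋₁ ⟶ ⋯ ⟶ P₀ ⟶ A`, and `⊤` if there is none of finite length. -/
noncomputable def projDim (A : C) : ℕ∞ :=
  ⨅ (n : ℕ) (_ : ∃ P, E.projectives P ∧ E.TriangleSeq E.projectives n P A), (n : ℕ∞)

/-- `Presⁿ(T)`: the objects `A` admitting an `E`-triangle sequence
`A' ⟶ Tₙ ⟶ ⋯ ⟶ T₁ ⟶ A` with all `Tᵢ` in `T`. -/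
def pres (n : ℕ) (T : ObjectProperty C) : ObjectProperty C := fun A =>
  ∃ A', E.TriangleSeq T n A' A

variable {E}

/-- The `i`-th syzygy `Ωⁱ X`, for the choice of projective presentations
`Ω A ⟶ P ⟶ A ⟶ ΣΩA` provided by the axiom of choice. -/
noncomputable def syzygy (hP : E.EnoughProjectives) : ℕ → C → C
  | 0, X => X
  | i + 1, X => (hP (syzygy hP i X)).choose

/-- The higher extension group `𝔼ⁱ⁺¹(X, Y) = 𝔼(Ωⁱ X, Y)`, for `i ≥ 0`. -/
noncomputable def extSucc (hP : E.EnoughProjectives) (i : ℕ) (X Y : C) :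
    AddSubgroup (syzygy hP i X ⟶ Y⟦(1 : ℤ)⟧) :=
  E.ext (syzygy hP i X) Y

/-- `T_E^⊥`: the objects `Y` with `𝔼ⁱ(X, Y) = 0` for all `X` in `T` and `i ≥ 1`. -/
def rightPerp (hP : E.EnoughProjectives) (T : ObjectProperty C) : ObjectProperty C := fun Y =>
  ∀ X, T X → ∀ i : ℕ, extSucc hP i X Y = ⊥

variable (E) in
/-- `S` is a generator for `R`: `S ⊆ R` and each `Y` in `R` has a triangle
`Y' ⟶ X ⟶ Y ⟶ ΣY'` in `E` with `X` in `S` and `Y'` in `R`. -/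
def IsGeneratorFor (S R : ObjectProperty C) : Prop :=
  S ≤ R ∧ ∀ Y, R Y → ∃ (Y' X : C) (f : Y' ⟶ X) (g : X ⟶ Y) (h : Y ⟶ Y'⟦(1 : ℤ)⟧),
    R Y' ∧ S X ∧ E.triangles (Triangle.mk f g h)

/-- The two conditions for an additive subcategory `T` closed under direct summands to be a
tilting subcategory of projective dimension `n` of `(C, E)`: each object of `T` has projective
dimension at most `n`, and `T` is a generator for `T_E^⊥`. -/
structure IsTilting (hP : E.EnoughProjectives) (n : ℕ) (T : ObjectProperty C) : Prop where
  projDim_le : ∀ X, T X → E.projDim X ≤ n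
  isGenerator : E.IsGeneratorFor T (rightPerp hP T)

end ProperClass

/-- A full additive subcategory closed under isomorphisms: it contains the zero objects and is
closed under binary, hence finite, direct sums. -/
structure IsAdditiveSubcategory {C : Type u} [Category.{v} C] [Preadditive C] [HasZeroObject C]
    [HasBinaryBiproducts C] (T : ObjectProperty C) : Prop where
  iso : ∀ {X Y : C}, (X ≅ Y) → T X → T Y
  zero : ∀ X : C, IsZero X → T X
  biprod : ∀ X Y : C, T X → T Y → T (X ⊞ Y)

/-- Closed under direct summands (for subcategories closed under isomorphisms, closure under
first summands gives closure under second summands). -/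
def IsClosedUnderSummands {C : Type u} [Category.{v} C] [Preadditive C] [HasBinaryBiproducts C]
    (T : ObjectProperty C) : Prop :=
  ∀ X Y : C, T (X ⊞ Y) → T X

/-- `f : X ⟶ A` is a right `T`-approximation of `A`. -/
def IsRightApproximation {C : Type u} [Category.{v} C] (T : ObjectProperty C) {X A : C}
    (f : X ⟶ A) : Prop :=
  T X ∧ ∀ (X' : C), T X' → ∀ g : X' ⟶ A, ∃ g' : X' ⟶ X, g' ≫ f = g

namespace ProperClass

variable {C : Type u} [Category.{v} C] [Preadditive C] [HasZeroObject C] [HasShift C ℤ]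
  [∀ n : ℤ, (shiftFunctor C n).Additive] [Pretriangulated C] {E : ProperClass C}

/-! The engine is dimension shifting: along an `E`-triangle sequence `K ⟶ Xₙ ⟶ ⋯ ⟶ X₁ ⟶ A` with all
`Xᵢ` in `T_E^⊥`, the groups `𝔼ⁱ(X, A)` and `𝔼ⁱ⁺ⁿ(X, K)` vanish together for `X` in `T` and `i ≥ 1`.

If `T` is tilting, iterating the generator triangles presents every object of `T_E^⊥`. Conversely,
for `A` in `Presⁿ(T)` the shift leads to `𝔼ⁱ⁺ⁿ(X, A')`, which is zero because `pd X ≤ n` makes the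
late syzygies of `X` projective.

If `Presⁿ(T) = T_E^⊥`, saturation puts the triangle of a right approximation in `E`, and its fiber
stays in `T_E^⊥`, so `T` is a generator. To bound `pd X`, coresolve any `Y` by `n` injectives, with
end term `N`. Injectives lie in `T_E^⊥`, and `IsGeneratorFor.pres_le` trades them for objects of
`T`; hence `N` is in `Presⁿ(T) = T_E^⊥`, and shifting `𝔼¹(X, N) = 0` gives `𝔼ⁿ⁺¹(X, Y) = 0`. -/

/-- The extension group `𝔼(Z, Y)` vanishes. -/
def ExtVanishes (E : ProperClass C) (Z Y : C) : Prop :=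
  ∀ h : Z ⟶ Y⟦(1 : ℤ)⟧, E.IsPhantom h → h = 0

/-! ### Phantom maps, projectives and injectives -/

lemma extSucc_eq_bot_iff (hP : E.EnoughProjectives) (i : ℕ) (X Y : C) :
    extSucc hP i X Y = ⊥ ↔ E.ExtVanishes (syzygy hP i X) Y :=
  AddSubgroup.eq_bot_iff_forall _

lemma IsPhantom.triangles {X Y Z : C} {f : X ⟶ Y} {g : Y ⟶ Z} {h : Z ⟶ X⟦(1 : ℤ)⟧}
    (hh : E.IsPhantom h) (hD : Triangle.mk f g h ∈ distTriang C) :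
    E.triangles (Triangle.mk f g h) := by
  obtain ⟨Y', f', g', hT⟩ := hh
  simpa using E.baseChange f' g' h (𝟙 Z) f g hT (by simpa using hD)

lemma projectives.exists_lift {P X Y Z : C} (hp : E.projectives P) {f : X ⟶ Y} {g : Y ⟶ Z}
    {h : Z ⟶ X⟦(1 : ℤ)⟧} (hT : E.triangles (Triangle.mk f g h)) (p : P ⟶ Z) :
    ∃ q : P ⟶ Y, q ≫ g = p :=
  hp _ hT p

lemma injectives.exists_extension {I X Y Z : C} (hi : E.injectives I) {f : X ⟶ Y} {g : Y ⟶ Z}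
    {h : Z ⟶ X⟦(1 : ℤ)⟧} (hT : E.triangles (Triangle.mk f g h)) (a : X ⟶ I) :
    ∃ b : Y ⟶ I, f ≫ b = a :=
  hi _ hT a

lemma projectives.extVanishes {P : C} (hp : E.projectives P) (Y : C) : E.ExtVanishes P Y := by
  rintro h ⟨W, f, g, hT⟩
  obtain ⟨b, hb⟩ := hp.exists_lift hT (𝟙 P)
  have h0 : g ≫ h = 0 := comp_distTriang_mor_zero₂₃ _ (E.distinguished _ hT)
  rw [← Category.id_comp h, ← hb, Category.assoc, h0, comp_zero]

lemma injectives.extVanishes {I : C} (hi : E.injectives I) (Z : C) : E.ExtVanishes Z I := by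
  rintro h ⟨W, f, g, hT⟩
  obtain ⟨b, hb⟩ := hi.exists_extension hT (𝟙 I)
  have h0 : h ≫ f⟦(1 : ℤ)⟧' = 0 := comp_distTriang_mor_zero₃₁ _ (E.distinguished _ hT)
  rw [← Category.comp_id h, ← (shiftFunctor C (1 : ℤ)).map_id, ← hb, Functor.map_comp,
    ← Category.assoc, h0, zero_comp]

lemma projectives_of_extVanishes {P : C} (h : ∀ Y, E.ExtVanishes P Y) : E.projectives P := by
  intro D hD c
  obtain ⟨b, hb⟩ := Triangle.coyoneda_exact₃ D (E.distinguished _ hD) c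
    (h _ _ (IsPhantom.precomp ⟨_, _, _, hD⟩ c))
  exact ⟨b, hb.symm⟩

/-- The base change along `ε` of the triangle on `h` has zero third morphism, hence splits;
saturation applies. -/
lemma isPhantom_of_splits_precomp {Z X M W : C} {m : M ⟶ W} {ε : W ⟶ Z} {k : Z ⟶ M⟦(1 : ℤ)⟧}
    (hε : E.triangles (Triangle.mk m ε k)) {h : Z ⟶ X⟦(1 : ℤ)⟧} (h0 : ε ≫ h = 0) :
    E.IsPhantom h := by
  obtain ⟨Y, f, g, hD⟩ := distinguished_cocone_triangle₂ h
  obtain ⟨Y', f', g', hT⟩ := E.isPhantom_zero W X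
  exact ⟨Y, f, g, E.saturated f g h m ε k f' g' hD hε (by rwa [h0])⟩

lemma isPhantom_of_projectives (hP : E.EnoughProjectives) {Z X : C} {h : Z ⟶ X⟦(1 : ℤ)⟧}
    (hh : ∀ (P : C) (p : P ⟶ Z), E.projectives P → p ≫ h = 0) : E.IsPhantom h := by
  obtain ⟨K, P, m, ε, k, hp, hT⟩ := hP Z
  exact isPhantom_of_splits_precomp hT (hh P ε hp)

/-! ### Extension closure and one-step dimension shifting -/

lemma extVanishes_mid (hP : E.EnoughProjectives) {A B D : C} {f : A ⟶ B} {g : B ⟶ D}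
    {h : D ⟶ A⟦(1 : ℤ)⟧} (hT : E.triangles (Triangle.mk f g h)) {Z : C}
    (hA : E.ExtVanishes Z A) (hD : E.ExtVanishes Z D) : E.ExtVanishes Z B := by
  intro u hu
  have hd := E.distinguished _ hT
  obtain ⟨k, hk⟩ : ∃ k : Z ⟶ A⟦(1 : ℤ)⟧, u = k ≫ f⟦(1 : ℤ)⟧' := by
    have hd' : Triangle.mk h (-f⟦(1 : ℤ)⟧') (-g⟦(1 : ℤ)⟧') ∈ distTriang C :=
      rot_of_distTriang _ (rot_of_distTriang _ hd)
    have hu0 : u ≫ (-g⟦(1 : ℤ)⟧') = 0 := by rw [Preadditive.comp_neg, hD _ (hu.postcomp g), neg_zero]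
    obtain ⟨k, hk⟩ : ∃ k : Z ⟶ A⟦(1 : ℤ)⟧, u = k ≫ (-f⟦(1 : ℤ)⟧') :=
      Triangle.coyoneda_exact₃ _ hd' u hu0
    exact ⟨-k, by rw [hk, Preadditive.comp_neg, Preadditive.neg_comp]⟩
  -- Exactness only yields some `k`; phantomness is tested on projectives, where `p ≫ k` factors
  -- through the phantom `h`.
  have hkp : E.IsPhantom k := by
    refine isPhantom_of_projectives hP fun P p hp => ?_
    have h0 : (p ≫ k) ≫ f⟦(1 : ℤ)⟧' = 0 := by
      rw [Category.assoc, ← hk, hp.extVanishes B _ (hu.precomp p)]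
    obtain ⟨c, hc⟩ : ∃ c : P ⟶ D, p ≫ k = c ≫ h := Triangle.coyoneda_exact₁ _ hd (p ≫ k) h0
    rw [hc]
    exact hp.extVanishes A _ (IsPhantom.precomp ⟨_, _, _, hT⟩ c)
  rw [hk, hA k hkp, zero_comp]

/-- With `L` a syzygy of `Z`, this and the next lemma are exactness of `𝔼¹(Z, B) ⟶ 𝔼¹(Z, D) ⟶ 𝔼²(Z,
A) ⟶ 𝔼²(Z, B)` at the two middle terms. -/
lemma extVanishes_shift_left {A B D : C} {f : A ⟶ B} {g : B ⟶ D} {h : D ⟶ A⟦(1 : ℤ)⟧}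
    (hT : E.triangles (Triangle.mk f g h)) {L Q Z : C} {i : L ⟶ Q} {p : Q ⟶ Z}
    {δ : Z ⟶ L⟦(1 : ℤ)⟧} (hS : E.triangles (Triangle.mk i p δ)) (hQ : E.projectives Q)
    (hD : E.ExtVanishes Z D) (hB : E.ExtVanishes L B) : E.ExtVanishes L A := by
  intro k hk
  obtain ⟨c, hc⟩ : ∃ c : L ⟶ D, k = c ≫ h :=
    Triangle.coyoneda_exact₁ _ (E.distinguished _ hT) k (hB _ (hk.postcomp f))
  have h0 : δ ≫ c⟦(1 : ℤ)⟧' = 0 := hD _ (IsPhantom.postcomp ⟨_, _, _, hS⟩ c)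
  obtain ⟨c', hc'⟩ : ∃ c' : Q ⟶ D, c = i ≫ c' := by
    have hd : Triangle.mk δ (-i⟦(1 : ℤ)⟧') (-p⟦(1 : ℤ)⟧') ∈ distTriang C :=
      rot_of_distTriang _ (rot_of_distTriang _ (E.distinguished _ hS))
    obtain ⟨w, hw⟩ : ∃ w : Q⟦(1 : ℤ)⟧ ⟶ D⟦(1 : ℤ)⟧, c⟦(1 : ℤ)⟧' = (-i⟦(1 : ℤ)⟧') ≫ w :=
      Triangle.yoneda_exact₂ _ hd (c⟦(1 : ℤ)⟧') h0
    obtain ⟨w', rfl⟩ := (shiftFunctor C (1 : ℤ)).map_surjective w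
    refine ⟨-w', (shiftFunctor C (1 : ℤ)).map_injective ?_⟩
    simpa using hw
  rw [hc, hc', Category.assoc, hQ.extVanishes A _ (IsPhantom.precomp ⟨_, _, _, hT⟩ c'), comp_zero]

lemma extVanishes_shift_right {A B D : C} {f : A ⟶ B} {g : B ⟶ D} {h : D ⟶ A⟦(1 : ℤ)⟧}
    (hT : E.triangles (Triangle.mk f g h)) {L Q Z : C} {i : L ⟶ Q} {p : Q ⟶ Z}
    {δ : Z ⟶ L⟦(1 : ℤ)⟧} (hS : E.triangles (Triangle.mk i p δ)) (hQ : E.projectives Q)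
    (hA : E.ExtVanishes L A) (hB : E.ExtVanishes Z B) : E.ExtVanishes Z D := by
  intro u hu
  obtain ⟨w, hw⟩ : ∃ w : L⟦(1 : ℤ)⟧ ⟶ D⟦(1 : ℤ)⟧, u = δ ≫ w :=
    Triangle.yoneda_exact₃ _ (E.distinguished _ hS) u (hQ.extVanishes D _ (hu.precomp p))
  obtain ⟨c, rfl⟩ := (shiftFunctor C (1 : ℤ)).map_surjective w
  obtain ⟨b, hb⟩ : ∃ b : L ⟶ B, c = b ≫ g :=
    Triangle.coyoneda_exact₃ _ (E.distinguished _ hT) c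
      (hA _ (IsPhantom.precomp ⟨_, _, _, hT⟩ c))
  rw [hw, hb, Functor.map_comp, ← Category.assoc, hB _ (IsPhantom.postcomp ⟨_, _, _, hS⟩ b),
    zero_comp]

/-! ### Triangle sequences and iterated shifting -/

lemma exists_syzygy_triangle (hP : E.EnoughProjectives) (i : ℕ) (X : C) :
    ∃ (P : C) (f : syzygy hP (i + 1) X ⟶ P) (g : P ⟶ syzygy hP i X)
      (h : syzygy hP i X ⟶ (syzygy hP (i + 1) X)⟦(1 : ℤ)⟧),
      E.projectives P ∧ E.triangles (Triangle.mk f g h) :=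
  (hP (syzygy hP i X)).choose_spec

lemma TriangleSeq.mono {S S' : ObjectProperty C} (hS : S ≤ S') {n : ℕ} {K A : C}
    (h : E.TriangleSeq S n K A) : E.TriangleSeq S' n K A := by
  induction h with
  | nil A => exact .nil A
  | cons f g h hD hX _ ih => exact .cons f g h hD (hS _ hX) ih

lemma TriangleSeq.snoc {S : ObjectProperty C} {n : ℕ} {K K' X A : C}
    (hs : E.TriangleSeq S n K A) (f : K' ⟶ X) (g : X ⟶ K) (h : K ⟶ K'⟦(1 : ℤ)⟧)
    (hT : E.triangles (Triangle.mk f g h)) (hX : S X) : E.TriangleSeq S (n + 1) K' A := by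
  induction hs with
  | nil A => exact .cons f g h hT hX (.nil _)
  | cons f' g' h' hD hX' _ ih => exact .cons f' g' h' hD hX' (ih g h hT)

lemma triangleSeq_syzygy (hP : E.EnoughProjectives) (n : ℕ) (X : C) :
    E.TriangleSeq E.projectives n (syzygy hP n X) X := by
  induction n with
  | zero => exact .nil X
  | succ n ih =>
    obtain ⟨P, f, g, h, hp, hT⟩ := exists_syzygy_triangle hP n X
    exact ih.snoc f g h hT hp

lemma exists_triangleSeq_injectives (hI : E.EnoughInjectives) (n : ℕ) (Y : C) :
    ∃ N, E.TriangleSeq E.injectives n Y N := by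
  induction n with
  | zero => exact ⟨Y, .nil Y⟩
  | succ n ih =>
    obtain ⟨N, hN⟩ := ih
    obtain ⟨I, N', f, g, h, hi, hT⟩ := hI N
    exact ⟨N', .cons f g h hT hi hN⟩

lemma TriangleSeq.extVanishes_left (hP : E.EnoughProjectives) {X : C} {S : ObjectProperty C}
    (hS : ∀ Y, S Y → ∀ i, E.ExtVanishes (syzygy hP i X) Y) {n : ℕ} {K A : C}
    (hs : E.TriangleSeq S n K A) (i : ℕ) (hA : E.ExtVanishes (syzygy hP i X) A) :
    E.ExtVanishes (syzygy hP (i + n) X) K := by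
  induction hs generalizing i with
  | nil A => exact hA
  | @cons n K L Y A f g h hD hY _ ih =>
    obtain ⟨P, f', g', h', hp, hT⟩ := exists_syzygy_triangle hP i X
    have := ih (i + 1) (extVanishes_shift_left hD hT hp hA (hS _ hY _))
    rwa [Nat.add_right_comm] at this

lemma TriangleSeq.extVanishes_right (hP : E.EnoughProjectives) {X : C} {S : ObjectProperty C}
    (hS : ∀ Y, S Y → ∀ i, E.ExtVanishes (syzygy hP i X) Y) {n : ℕ} {K A : C}
    (hs : E.TriangleSeq S n K A) (i : ℕ) (hK : E.ExtVanishes (syzygy hP (i + n) X) K) :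
    E.ExtVanishes (syzygy hP i X) A := by
  induction hs generalizing i with
  | nil A => exact hK
  | @cons n K L Y A f g h hD hY _ ih =>
    obtain ⟨P, f', g', h', hp, hT⟩ := exists_syzygy_triangle hP i X
    refine extVanishes_shift_right hD hT hp (ih (i + 1) ?_) (hS _ hY _)
    rwa [Nat.add_right_comm]

/-- Balancing: each step trades one syzygy of `Z` for one cosyzygy, until the first argument is the
projective `P`. This replaces a comparison of resolutions by Schanuel's lemma. -/
lemma TriangleSeq.extVanishes_of_injectives {n : ℕ} {P Z : C}
    (hs : E.TriangleSeq E.projectives n P Z) (hp : E.projectives P) {Y N : C}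
    (hN : E.TriangleSeq E.injectives n Y N) : E.ExtVanishes Z N := by
  induction hs generalizing N with
  | nil A => exact hp.extVanishes N
  | cons f g h hD hX _ ih =>
    cases hN with
    | cons f' g' h' hD' hI' hN' =>
      exact extVanishes_shift_right hD' hD hX (ih hp hN') (hI'.extVanishes _)

/-! ### Projective dimension via syzygies -/

/-- Syzygies eventually become projective along a finite projective resolution. -/
lemma TriangleSeq.projectives_syzygy (hP : E.EnoughProjectives) (hI : E.EnoughInjectives)
    {m : ℕ} {P X : C} (hs : E.TriangleSeq E.projectives m P X) (hp : E.projectives P) :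
    E.projectives (syzygy hP m X) := by
  refine projectives_of_extVanishes fun Y => ?_
  obtain ⟨N, hN⟩ := exists_triangleSeq_injectives hI m Y
  simpa using hN.extVanishes_left hP (X := X) (fun J hJ i => hJ.extVanishes _) 0
    (hs.extVanishes_of_injectives hp hN)

lemma projectives_syzygy_of_le (hP : E.EnoughProjectives) (hI : E.EnoughInjectives) {X : C}
    {m n : ℕ} (hmn : m ≤ n) (hm : E.projectives (syzygy hP m X)) :
    E.projectives (syzygy hP n X) := by
  induction n, hmn using Nat.le_induction with
  | base => exact hm
  | succ n _ ih =>
    refine projectives_of_extVanishes fun Y => ?_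
    obtain ⟨J, N, f, g, h, hJ, hT⟩ := hI Y
    obtain ⟨Q, f', g', h', hQ, hT'⟩ := exists_syzygy_triangle hP n X
    exact extVanishes_shift_left hT hT' hQ (ih.extVanishes N) (hJ.extVanishes _)

lemma projDim_le_iff (hP : E.EnoughProjectives) (hI : E.EnoughInjectives) (X : C) (n : ℕ) :
    E.projDim X ≤ n ↔ E.projectives (syzygy hP n X) := by
  constructor
  · intro h
    by_contra hn
    -- If `Ωⁿ X` is not projective, no resolution has length at most `n`, which bounds the infimum
    -- below.
    have : ((n + 1 : ℕ) : ℕ∞) ≤ E.projDim X := by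
      refine le_iInf₂ fun m ⟨P, hp, hs⟩ => ?_
      by_contra hlt
      have hmn : m ≤ n := by
        have : m < n + 1 := by exact_mod_cast not_le.mp hlt
        omega
      exact hn (projectives_syzygy_of_le hP hI hmn (hs.projectives_syzygy hP hI hp))
    have := this.trans h
    norm_cast at this
    omega
  · intro h
    exact iInf₂_le n ⟨_, h, triangleSeq_syzygy hP n X⟩

lemma rightPerp_iff {hP : E.EnoughProjectives} {T : ObjectProperty C} {Y : C} :
    rightPerp hP T Y ↔ ∀ X, T X → ∀ i, E.ExtVanishes (syzygy hP i X) Y := by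
  simp only [rightPerp, extSucc_eq_bot_iff]

lemma injectives_le_rightPerp (hP : E.EnoughProjectives) (T : ObjectProperty C) :
    E.injectives ≤ rightPerp hP T :=
  fun _ hJ => rightPerp_iff.2 fun _ _ _ => hJ.extVanishes _

lemma rightPerp_of_triangle {hP : E.EnoughProjectives} {T : ObjectProperty C} {A B D : C}
    {f : A ⟶ B} {g : B ⟶ D} {h : D ⟶ A⟦(1 : ℤ)⟧} (hT : E.triangles (Triangle.mk f g h))
    (hA : rightPerp hP T A) (hD : rightPerp hP T D) : rightPerp hP T B :=
  rightPerp_iff.2 fun X hX i =>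
    extVanishes_mid hP hT (rightPerp_iff.1 hA X hX i) (rightPerp_iff.1 hD X hX i)

/-! ### Composing and pulling back triangles of `E` -/

/-- The octahedral axiom for the fibers of a composition. -/
lemma distinguished_fiber_triangle [IsTriangulated C] {X₁ X₂ X₃ K₁₂ K₂₃ K₁₃ : C}
    {i₁₂ : K₁₂ ⟶ X₁} {u₁₂ : X₁ ⟶ X₂} {h₁₂ : X₂ ⟶ K₁₂⟦(1 : ℤ)⟧}
    {i₂₃ : K₂₃ ⟶ X₂} {u₂₃ : X₂ ⟶ X₃} {h₂₃ : X₃ ⟶ K₂₃⟦(1 : ℤ)⟧}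
    {i₁₃ : K₁₃ ⟶ X₁} {h₁₃ : X₃ ⟶ K₁₃⟦(1 : ℤ)⟧}
    (h₁ : Triangle.mk i₁₂ u₁₂ h₁₂ ∈ distTriang C)
    (h₂ : Triangle.mk i₂₃ u₂₃ h₂₃ ∈ distTriang C)
    (h₃ : Triangle.mk i₁₃ (u₁₂ ≫ u₂₃) h₁₃ ∈ distTriang C) :
    ∃ (a : K₁₂ ⟶ K₁₃) (b : K₁₃ ⟶ K₂₃), Triangle.mk a b (i₂₃ ≫ h₁₂) ∈ distTriang C := by
  have h₁' : Triangle.mk u₁₂ h₁₂ (-i₁₂⟦(1 : ℤ)⟧') ∈ distTriang C := rot_of_distTriang _ h₁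
  have h₂' : Triangle.mk u₂₃ h₂₃ (-i₂₃⟦(1 : ℤ)⟧') ∈ distTriang C := rot_of_distTriang _ h₂
  have h₃' : Triangle.mk (u₁₂ ≫ u₂₃) h₁₃ (-i₁₃⟦(1 : ℤ)⟧') ∈ distTriang C :=
    rot_of_distTriang _ h₃
  have o := Triangulated.someOctahedron rfl h₁' h₂' h₃'
  obtain ⟨a, ha⟩ := (shiftFunctor C (1 : ℤ)).map_surjective o.m₁
  obtain ⟨b, hb⟩ := (shiftFunctor C (1 : ℤ)).map_surjective o.m₃
  have ho : Triangle.mk (a⟦(1 : ℤ)⟧') (b⟦(1 : ℤ)⟧')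
      ((-i₂₃⟦(1 : ℤ)⟧') ≫ h₁₂⟦(1 : ℤ)⟧') ∈ distTriang C := by
    rw [ha, hb]
    exact o.mem
  refine ⟨a, b, ?_⟩
  -- Three rotations suspend the triangle and negate all its maps; `-𝟙` on the middle object absorbs
  -- the extra signs.
  rw [rotate_distinguished_triangle, rotate_distinguished_triangle, rotate_distinguished_triangle]
  change Triangle.mk (-a⟦(1 : ℤ)⟧') (-b⟦(1 : ℤ)⟧') (-(i₂₃ ≫ h₁₂)⟦(1 : ℤ)⟧') ∈ distTriang C
  refine isomorphic_distinguished _ ho _ (Triangle.isoMk _ _ (Iso.refl _)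
    (-Iso.refl _) (Iso.refl _) ?_ ?_ ?_)
  · change (-a⟦(1 : ℤ)⟧') ≫ (-𝟙 (K₁₃⟦(1 : ℤ)⟧)) = 𝟙 (K₁₂⟦(1 : ℤ)⟧) ≫ a⟦(1 : ℤ)⟧'
    simp
  · change (-b⟦(1 : ℤ)⟧') ≫ 𝟙 (K₂₃⟦(1 : ℤ)⟧) = (-𝟙 (K₁₃⟦(1 : ℤ)⟧)) ≫ b⟦(1 : ℤ)⟧'
    simp
  · change (-(i₂₃ ≫ h₁₂)⟦(1 : ℤ)⟧') ≫ (𝟙 (K₁₂⟦(1 : ℤ)⟧))⟦(1 : ℤ)⟧' =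
      𝟙 (K₂₃⟦(1 : ℤ)⟧) ≫ (-i₂₃⟦(1 : ℤ)⟧') ≫ h₁₂⟦(1 : ℤ)⟧'
    simp

/-- `E`-proper epimorphisms onto an object compose. -/
lemma exists_triangle_comp [IsTriangulated C] (hP : E.EnoughProjectives) {X₁ X₂ X₃ K₁₂ K₂₃ : C}
    {i₁₂ : K₁₂ ⟶ X₁} {u₁₂ : X₁ ⟶ X₂} {h₁₂ : X₂ ⟶ K₁₂⟦(1 : ℤ)⟧}
    {i₂₃ : K₂₃ ⟶ X₂} {u₂₃ : X₂ ⟶ X₃} {h₂₃ : X₃ ⟶ K₂₃⟦(1 : ℤ)⟧}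
    (h₁ : E.triangles (Triangle.mk i₁₂ u₁₂ h₁₂)) (h₂ : E.triangles (Triangle.mk i₂₃ u₂₃ h₂₃)) :
    ∃ (L : C) (i : L ⟶ X₁) (u : X₁ ⟶ X₃) (h : X₃ ⟶ L⟦(1 : ℤ)⟧) (a : K₁₂ ⟶ L) (b : L ⟶ K₂₃)
      (c : K₂₃ ⟶ K₁₂⟦(1 : ℤ)⟧),
      E.triangles (Triangle.mk i u h) ∧ E.triangles (Triangle.mk a b c) := by
  obtain ⟨L, i, h, hd⟩ := distinguished_cocone_triangle₁ (u₁₂ ≫ u₂₃)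
  obtain ⟨a, b, hab⟩ := distinguished_fiber_triangle (E.distinguished _ h₁)
    (E.distinguished _ h₂) hd
  refine ⟨L, i, u₁₂ ≫ u₂₃, h, a, b, i₂₃ ≫ h₁₂, IsPhantom.triangles ?_ hd,
    IsPhantom.triangles (IsPhantom.precomp ⟨_, _, _, h₁⟩ _) hab⟩
  refine isPhantom_of_projectives hP fun P p hp => ?_
  obtain ⟨q, hq⟩ := hp.exists_lift h₂ p
  obtain ⟨r, hr⟩ := hp.exists_lift h₁ q
  have h0 : (u₁₂ ≫ u₂₃) ≫ h = 0 := comp_distTriang_mor_zero₂₃ _ hd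
  rw [← hq, ← hr]
  simp only [Category.assoc] at h0 ⊢
  rw [h0, comp_zero]

/-- Pulling back a triangle along a proper epimorphism. -/
lemma exists_triangle_pullback [IsTriangulated C] {X L K M K' : C}
    {a : X ⟶ L} {p : L ⟶ K} {k : K ⟶ X⟦(1 : ℤ)⟧} {b : K' ⟶ M} {g : M ⟶ K} {w : K ⟶ K'⟦(1 : ℤ)⟧}
    (h₁ : E.triangles (Triangle.mk a p k)) (h₂ : E.triangles (Triangle.mk b g w)) :
    ∃ (Y : C) (i : K' ⟶ Y) (u : Y ⟶ L) (h : L ⟶ K'⟦(1 : ℤ)⟧) (c : X ⟶ Y) (d : Y ⟶ M)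
      (e : M ⟶ X⟦(1 : ℤ)⟧), E.triangles (Triangle.mk i u h) ∧ E.triangles (Triangle.mk c d e) := by
  obtain ⟨Y, i, u, hT⟩ := IsPhantom.precomp ⟨_, _, _, h₂⟩ p
  -- Octahedron for `p` followed by `w`: the fiber of `w` is `M`, that of `p ≫ w` is `Y`.
  obtain ⟨c, d, hcd⟩ := distinguished_fiber_triangle (E.distinguished _ h₁)
    (rot_of_distTriang _ (E.distinguished _ h₂)) (rot_of_distTriang _ (E.distinguished _ hT))
  exact ⟨Y, i, u, _, c, d, _, hT, IsPhantom.triangles (IsPhantom.precomp ⟨_, _, _, h₁⟩ _) hcd⟩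

/-! ### Presentations and the two implications -/

/-- If `S` generates an extension closed `R`, then objects with a presentation of length `m` by
objects of `R` have one of the same length by objects of `S`. -/
lemma IsGeneratorFor.pres_le [IsTriangulated C] (hP : E.EnoughProjectives)
    {T : ObjectProperty C} (hG : E.IsGeneratorFor T (rightPerp hP T)) (m : ℕ) :
    E.pres m (rightPerp hP T) ≤ E.pres m T := by
  induction m with
  | zero =>
    rintro A ⟨_, h⟩
    cases h
    exact ⟨A, .nil A⟩
  | succ m ih =>
    rintro A ⟨K, hs⟩
    cases hs with
    | cons f g h hD hX hL =>
      obtain ⟨X', T₁, f₁, g₁, h₁, hX', hT₁, hD₁⟩ := hG.2 _ hX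
      obtain ⟨L, i, u, e, a, b, c, hTL, hTab⟩ := exists_triangle_comp hP hD₁ hD
      -- The new kernel `L` extends the old one by `X'`. Pulling back the next triangle replaces
      -- `X₂` by an extension `Y` of `X₂` by `X'`, still in `T_E^⊥`, and leaves the tail unchanged.
      have : E.pres m (rightPerp hP T) L := by
        cases hL with
        | nil => exact ⟨L, .nil L⟩
        | cons f₂ g₂ h₂ hD₂ hX₂ hL₂ =>
          obtain ⟨Y, i', u', e', a', b', c', hY, hY'⟩ := exists_triangle_pullback hTab hD₂
          exact ⟨K, .cons i' u' e' hY (rightPerp_of_triangle hY' hX' hX₂) hL₂⟩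
      obtain ⟨K', hK'⟩ := ih L this
      exact ⟨K', .cons i u e hTL hT₁ hK'⟩

lemma IsGeneratorFor.le_pres {S R : ObjectProperty C} (hG : E.IsGeneratorFor S R) (n : ℕ) :
    R ≤ E.pres n S := by
  induction n with
  | zero => exact fun A _ => ⟨A, .nil A⟩
  | succ n ih =>
    intro A hA
    obtain ⟨A', X, f, g, h, hA', hX, hD⟩ := hG.2 A hA
    obtain ⟨K, hK⟩ := ih A' hA'
    exact ⟨K, .cons f g h hD hX hK⟩

lemma IsTilting.pres_eq {hP : E.EnoughProjectives} (hI : E.EnoughInjectives) {n : ℕ}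
    {T : ObjectProperty C} (hT : IsTilting hP n T) : E.pres n T = rightPerp hP T := by
  refine le_antisymm ?_ (hT.isGenerator.le_pres n)
  rintro A ⟨K, hs⟩
  refine rightPerp_iff.2 fun X hX i => hs.extVanishes_right hP
    (fun Y hY => rightPerp_iff.1 (hT.isGenerator.1 Y hY) X hX) i ?_
  exact (projectives_syzygy_of_le hP hI (Nat.le_add_left n i)
    ((projDim_le_iff hP hI X n).1 (hT.projDim_le X hX))).extVanishes K

lemma le_pres {T : ObjectProperty C} (h0 : ∀ X : C, IsZero X → T X) {n : ℕ} (hn : 1 ≤ n) :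
    T ≤ E.pres n T := by
  obtain ⟨Z₀, hZ₀⟩ := HasZeroObject.zero (C := C)
  have key (X : C) : E.triangles (Triangle.mk (0 : Z₀ ⟶ X) (𝟙 X) 0) :=
    E.splitting _ (isomorphic_distinguished _ (contractible_distinguished₁ X) _
      (Triangle.isoMk _ _ (hZ₀.iso (isZero_zero C)) (Iso.refl _) (Iso.refl _)
        (hZ₀.eq_of_src _ _)
        ((Category.comp_id (𝟙 X)).trans (Category.id_comp (𝟙 X)).symm)
        (zero_comp.trans comp_zero.symm))) rfl
  have hz (m : ℕ) : E.TriangleSeq T m Z₀ Z₀ := by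
    induction m with
    | zero => exact .nil _
    | succ m ih => exact .cons _ _ _ (key _) (h0 _ hZ₀) ih
  obtain ⟨m, rfl⟩ := Nat.exists_eq_add_of_le' hn
  -- The identity of `X`, padded with zero objects; `n ≥ 1` leaves room for `X` itself.
  exact fun X hX => ⟨_, .cons _ _ _ (key X) hX (hz m)⟩

/-- Kernels of right approximations by `T` of objects of `T_E^⊥` lie in `T_E^⊥`, as soon as the
objects of `T_E^⊥` are presented by objects of `T`. -/
lemma isGeneratorFor_of_pres_eq {hP : E.EnoughProjectives} {T : ObjectProperty C}
    (h0 : ∀ X : C, IsZero X → T X) {n : ℕ} (hn : 1 ≤ n)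
    (happrox : ∀ A : C, rightPerp hP T A → ∃ (X : C) (f : X ⟶ A), IsRightApproximation T f)
    (hpres : E.pres n T = rightPerp hP T) : E.IsGeneratorFor T (rightPerp hP T) := by
  have hle : T ≤ rightPerp hP T := hpres ▸ le_pres h0 hn
  refine ⟨hle, fun A hA => ?_⟩
  obtain ⟨X, g, hX, hg⟩ := happrox A hA
  obtain ⟨A', f, h, hd⟩ := distinguished_cocone_triangle₁ g
  have hgh : g ≫ h = 0 := comp_distTriang_mor_zero₂₃ _ hd
  have hph : E.IsPhantom h := by
    obtain ⟨K, hs⟩ : E.pres n T A := hpres ▸ hA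
    obtain ⟨m, rfl⟩ := Nat.exists_eq_add_of_le' hn
    cases hs with
    | cons f₁ g₁ h₁ hD hT₁ _ =>
      -- The first map of a presentation factors through the approximation `g`, so it kills `h`.
      obtain ⟨s, hs⟩ := hg _ hT₁ g₁
      exact isPhantom_of_splits_precomp hD (by rw [← hs, Category.assoc, hgh, comp_zero])
  have hT := hph.triangles hd
  refine ⟨A', X, f, g, h, rightPerp_iff.2 fun Z hZ i => ?_, hX, hT⟩
  have hXp := rightPerp_iff.1 (hle X hX) Z hZ
  cases i with
  | zero =>
    intro k hk
    -- `𝔼(Z, X) = 0` makes `k` factor through `h`; the approximation property then lifts `c` through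
    -- `g`.
    obtain ⟨c, hc⟩ : ∃ c : Z ⟶ A, k = c ≫ h :=
      Triangle.coyoneda_exact₁ _ hd k (hXp 0 _ (hk.postcomp f))
    obtain ⟨s, rfl⟩ := hg Z hZ c
    rw [hc, Category.assoc, hgh]
    exact comp_zero
  | succ i =>
    obtain ⟨P, f', g', h', hp, hS⟩ := exists_syzygy_triangle hP i Z
    exact extVanishes_shift_left hT hS hp (rightPerp_iff.1 hA Z hZ i) (hXp (i + 1))

lemma isTilting_of_pres_eq [IsTriangulated C] {hP : E.EnoughProjectives}
    (hI : E.EnoughInjectives) {T : ObjectProperty C} (h0 : ∀ X : C, IsZero X → T X) {n : ℕ}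
    (hn : 1 ≤ n)
    (happrox : ∀ A : C, rightPerp hP T A → ∃ (X : C) (f : X ⟶ A), IsRightApproximation T f)
    (hpres : E.pres n T = rightPerp hP T) : IsTilting hP n T := by
  have hG := isGeneratorFor_of_pres_eq h0 hn happrox hpres
  refine ⟨fun X hX => (projDim_le_iff hP hI X n).2 (projectives_of_extVanishes fun Y => ?_), hG⟩
  obtain ⟨N, hN⟩ := exists_triangleSeq_injectives hI n Y
  have hN' : rightPerp hP T N :=
    hpres ▸ hG.pres_le hP n N ⟨Y, hN.mono (injectives_le_rightPerp hP T)⟩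
  simpa using hN.extVanishes_left hP (X := X) (fun J hJ i => hJ.extVanishes _) 0
    (rightPerp_iff.1 hN' X hX 0)

end ProperClass

theorem theorem5p11 {C : Type u} [Category.{v} C] [Preadditive C] [HasZeroObject C]
    [HasShift C ℤ] [∀ n : ℤ, (shiftFunctor C n).Additive] [Pretriangulated C] [IsTriangulated C]
    (E : ProperClass C) (hP : E.EnoughProjectives) (_hI : E.EnoughInjectives)
    (n : ℕ) (_hn : 1 ≤ n) (T : ObjectProperty C)
    (_hT : IsAdditiveSubcategory T) (_hsummand : IsClosedUnderSummands T)
    (_happrox : ∀ A : C, ProperClass.rightPerp hP T A →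
      ∃ (X : C) (f : X ⟶ A), IsRightApproximation T f) :
    ProperClass.IsTilting hP n T ↔ E.pres n T = ProperClass.rightPerp hP T := by
  exact ⟨fun h => h.pres_eq _hI,
    ProperClass.isTilting_of_pres_eq _hI _hT.zero _hn _happrox⟩
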